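/- Let $k$ be an algebraically closed field of characteristic zero, and let $X$ be an algebraic variety over $k$ (a reduced separated scheme of finite type over $k$, not necessarily irreducible). Suppose that $X$ is toral, i.e. that $X$ is isomorphic over $k$ to a closed subvariety of $\mathbf{A}^n\setminus\bigcup_{i=1}^n H_i$ for some integer $n\ge 0$, where $H_i$ is the set of zeros of the $i$-th standard coordinate function on $\mathbf{A}^n$. Then the group $\mathrm{Aut}(X)$ of automorphisms of $X$ over $k$ is Jordan: there exists a positive integer $d$, depending only on $\mathrm{Aut}(X)$, such that every finite subgroup $K$ of $\mathrm{Aut}(X)$ contains a normal abelian subgroup of $K$ whose index in $K$ is at most $d$. -/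

import Mathlib

open AlgebraicGeometry CategoryTheory

universe u

/-- A group `G` is Jordan if there is a positive integer `d` such that every finite subgroup `K`
of `G` contains a normal (in `K`) abelian subgroup of index at most `d` in `K`. -/
def IsJordanGroup (G : Type*) [Group G] : Prop :=
  ∃ d : ℕ, 0 < d ∧ ∀ K : Subgroup G, Finite K →
    ∃ A : Subgroup K, A.Normal ∧ (∀ a ∈ A, ∀ b ∈ A, a * b = b * a) ∧ A.index ≤ d

/-- A `k`-scheme is a variety if it is reduced, separated and of finite type over `k`;
it need be neither irreducible nor connected. Over an algebraically closed field the category of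
these is equivalent to that of algebraic varieties in the sense of Serre. -/
structure IsVarietyOver (k : Type u) [Field k] (X : Over (Spec (CommRingCat.of k))) : Prop where
  isReduced : AlgebraicGeometry.IsReduced X.left
  isSeparated : IsSeparated X.hom
  locallyOfFiniteType : LocallyOfFiniteType X.hom
  quasiCompact : QuasiCompact X.hom

/-- The open subset of affine `n`-space over `k` where no standard coordinate function vanishes,
that is, the complement of the union of the `n` coordinate hyperplanes. -/
noncomputable def coordTorusOpens (k : Type u) [Field k] (n : ℕ) :
    (AffineSpace (ULift.{u} (Fin n)) (Spec (CommRingCat.of k))).Opens :=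
  ⨅ i : ULift.{u} (Fin n), (AffineSpace (ULift.{u} (Fin n)) (Spec (CommRingCat.of k))).basicOpen
    (AffineSpace.coord (Spec (CommRingCat.of k)) i)

/-- The `n`-dimensional torus as a `k`-scheme: the open subscheme of affine `n`-space
complementary to the coordinate hyperplanes. -/
noncomputable def coordTorus (k : Type u) [Field k] (n : ℕ) : Over (Spec (CommRingCat.of k)) :=
  Over.mk ((coordTorusOpens k n).ι ≫
    (AffineSpace (ULift.{u} (Fin n)) (Spec (CommRingCat.of k)) ↘ Spec (CommRingCat.of k)))

/-- A variety `X` over `k` is toral if it is isomorphic to a closed subvariety of some torus,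
i.e. if it admits a closed immersion over `k` into a torus. -/
def IsToral (k : Type u) [Field k] (X : Over (Spec (CommRingCat.of k))) : Prop :=
  ∃ (n : ℕ) (i : X ⟶ coordTorus k n), IsClosedImmersion i.left

/-! A toral variety is affine and its coordinate ring `A` is generated by units, so an automorphism
is determined by its effect on the unit group. Let `T` be the group of units that are constant on
each irreducible component. Rosenlicht's theorem (`exists_units_addMonoidHom_mem_range`), applied to
each component, makes the quotient of the units by `T` finitely generated; it is torsion-free
because `k` is algebraically closed.

Thus the automorphisms act on a finite set, the minimal primes, and on a lattice, the units modulo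
`T`. An automorphism trivial on both fixes `T` pointwise, `A` being reduced, and multiplies each
unit by an element of `T`; two of these commute on units, hence everywhere. In a finite group `K`
they form a normal abelian subgroup, whose index is bounded independently of `K` by Minkowski's
theorem (`exists_forall_index_ker_le`). -/

/-! ### Minkowski's bound -/

/-- An element of finite prime order of a torsion-free ring that is congruent to `1` modulo `3 ^ a`
is congruent to `1` modulo `3 ^ (a + 1)`. -/
theorem three_pow_succ_dvd_sub_one {R : Type*} [Ring R] [IsAddTorsionFree R] {p a : ℕ}
    (hp : p.Prime) (ha : 1 ≤ a) {g h : R} (hg : g ^ p = 1) (hh : g = 1 + (3 ^ a : ℕ) • h) :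
    ∃ h', g = 1 + (3 ^ (a + 1) : ℕ) • h' := by
  obtain ⟨b, rfl⟩ : ∃ b, a = b + 1 := ⟨a - 1, by omega⟩
  suffices ∃ h', h = (3 : ℕ) • h' by
    obtain ⟨h', rfl⟩ := this
    exact ⟨h', by rw [hh, smul_smul, pow_succ 3 (b + 1)]⟩
  by_cases h3 : p = 3
  · subst h3
    -- The expansion is done in `ℤ[X]`, where `ring` applies, then evaluated at `h`, as `R` need not
    -- be commutative.
    have key : ((3 ^ (b + 2) : ℕ) : Polynomial ℤ) * (.X + 3 * ((3 ^ b : ℕ) * (.X ^ 2) +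
        ((3 ^ (2 * b) : ℕ) * .X ^ 3))) = (1 + (3 ^ (b + 1) : ℕ) * .X) ^ 3 - 1 := by
      push_cast; ring
    have h1 := congrArg (Polynomial.aeval h) key
    simp only [map_mul, map_add, map_sub, map_pow, map_natCast, Polynomial.aeval_X, map_one,
      map_ofNat] at h1
    rw [← nsmul_eq_mul _ h, ← hh, hg, sub_self, ← nsmul_eq_mul,
      smul_eq_zero_iff_right (by positivity)] at h1
    refine ⟨-((3 ^ b : ℕ) * (h ^ 2) + (3 ^ (2 * b) : ℕ) * h ^ 3), ?_⟩
    rw [smul_neg, eq_neg_iff_add_eq_zero, nsmul_eq_mul]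
    exact_mod_cast h1
  · obtain ⟨q, hq⟩ := Polynomial.powAddExpansion (1 : Polynomial ℤ) ((3 ^ (b + 1) : ℕ) * .X) p
    have key : ((3 ^ (b + 1) : ℕ) : Polynomial ℤ) * (p * .X + 3 * ((3 ^ b : ℕ) * (q * .X ^ 2))) =
        (1 + (3 ^ (b + 1) : ℕ) * .X) ^ p - 1 := by
      rw [hq]; push_cast; ring
    have h1 := congrArg (Polynomial.aeval h) key
    simp only [map_mul, map_add, map_sub, map_pow, map_natCast, Polynomial.aeval_X, map_one,
      map_ofNat] at h1
    rw [← nsmul_eq_mul (3 ^ (b + 1)) h, ← hh, hg, sub_self, ← nsmul_eq_mul,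
      smul_eq_zero_iff_right (by positivity)] at h1
    have hc : IsCoprime (p : ℤ) (3 : ℕ) :=
      Nat.isCoprime_iff_coprime.2 ((Nat.coprime_primes hp Nat.prime_three).2 h3)
    obtain ⟨s, t, hst⟩ := hc
    generalize ((3 ^ b : ℕ) : R) * (Polynomial.aeval h q * h ^ 2) = y at h1
    have hs : (s : R) * p + t * 3 = 1 := by exact_mod_cast congrArg (Int.cast : ℤ → R) hst
    -- Here `p * h + 3 * y = 0`; the Bézout relation solves this for `h` modulo 3.
    refine ⟨t * h - s * y, ?_⟩
    calc h = (s * p + t * 3) * h := by rw [hs, one_mul]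
      _ = s * (p * h + 3 * y) + 3 * (t * h - s * y) := by
        have h3s : (3 : R) * (s * y) = s * (3 * y) := by
          rw [← mul_assoc, ← mul_assoc (s : R), (Commute.ofNat_left 3 (s : R)).eq]
        have h3t : (3 : R) * (t * h) = t * 3 * h := by
          rw [← mul_assoc, (Commute.ofNat_left 3 (t : R)).eq]
        rw [mul_sub, h3s, h3t, add_mul, mul_add, mul_assoc]; abel
      _ = 3 • (t * h - s * y) := by rw [h1, mul_zero, zero_add, nsmul_eq_mul]; rfl

/-- An element of a finite free `ℤ`-module divisible by all powers of `3` vanishes. -/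
theorem eq_zero_of_forall_three_pow_dvd {M : Type*} [AddCommGroup M] [Module.Finite ℤ M]
    [Module.Free ℤ M] {x : M} (hx : ∀ a : ℕ, 1 ≤ a → ∃ y, x = (3 ^ a : ℕ) • y) : x = 0 := by
  let b := Module.Free.chooseBasis ℤ M
  refine b.ext_elem fun i => ?_
  rw [map_zero, Finsupp.zero_apply]
  by_contra hne
  obtain ⟨y, hy⟩ := hx ((b.repr x i).natAbs + 1) (by omega)
  have hd : (3 ^ ((b.repr x i).natAbs + 1) : ℤ) ∣ b.repr x i := by
    refine ⟨b.repr y i, ?_⟩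
    conv_lhs => rw [hy]
    simp
  have h1 := Int.natAbs_le_of_dvd_ne_zero hd hne
  have h2 : (b.repr x i).natAbs + 1 < 3 ^ ((b.repr x i).natAbs + 1) :=
    Nat.lt_pow_self (by norm_num)
  rw [Int.natAbs_pow] at h1
  norm_num at h1
  omega

/-- **Minkowski's lemma**: in a ring whose additive group is free of finite rank, an element of
finite multiplicative order that is congruent to `1` modulo `3` equals `1`. -/
theorem eq_one_of_pow_eq_one_of_three_dvd {R : Type*} [Ring R] [Module.Finite ℤ R]
    [Module.Free ℤ R] {m : ℕ} (hm : 0 < m) {g : R} (hg : g ^ m = 1)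
    (h : ∃ h, g - 1 = (3 : ℕ) • h) : g = 1 := by
  have : IsAddTorsionFree R := Module.isTorsionFree_int_iff_isAddTorsionFree.1 inferInstance
  induction m using Nat.strong_induction_on generalizing g with
  | _ m ih =>
    by_cases h1 : m = 1
    · simpa [h1] using hg
    obtain ⟨p, hp, n, rfl⟩ := Nat.exists_prime_and_dvd h1
    have hn : 0 < n := Nat.pos_of_mul_pos_left hm
    -- It remains to show that `g ^ n`, whose `p`-th power is 1, equals 1: its congruence to 1
    -- modulo 3 improves to every power of 3.
    refine ih n ((Nat.lt_mul_iff_one_lt_left hn).2 hp.one_lt) hn ?_ h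
    have hpow : (g ^ n) ^ p = 1 := by rw [← pow_mul, mul_comm, hg]
    have hstep : ∀ a : ℕ, 1 ≤ a → ∃ y, g ^ n = 1 + (3 ^ a : ℕ) • y := by
      intro a ha
      induction a, ha using Nat.le_induction with
      | base =>
        obtain ⟨y, hy⟩ := h
        obtain ⟨z, hz⟩ : g - 1 ∣ g ^ n - 1 := by
          simpa using (Commute.one_right g).sub_dvd_pow_sub_pow n
        exact ⟨y * z, by rw [pow_one, ← smul_mul_assoc, ← hy, ← hz]; abel⟩
      | succ a ha ih' =>
        obtain ⟨y, hy⟩ := ih'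
        exact three_pow_succ_dvd_sub_one hp ha hpow hy
    refine sub_eq_zero.1 (eq_zero_of_forall_three_pow_dvd fun a ha => ?_)
    obtain ⟨y, hy⟩ := hstep a ha
    exact ⟨y, by rw [hy]; abel⟩

/-- **Minkowski's theorem**: the orders of the finite groups of units of a ring whose additive group
is free of finite rank are bounded. -/
theorem exists_forall_index_ker_le (R : Type*) [Ring R] [Module.Finite ℤ R] [Module.Free ℤ R] :
    ∃ d : ℕ, 0 < d ∧ ∀ (K : Type u) [Group K] [Finite K] (ρ : K →* R), ρ.ker.index ≤ d := by
  let b := Module.Free.chooseBasis ℤ R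
  let Y := Module.Free.ChooseBasisIndex ℤ R → ZMod 3
  -- `Y` models `R / 3R`. Cosets of the kernel with the same image there coincide, by Minkowski's
  -- lemma.
  refine ⟨Nat.card Y, Nat.card_pos, fun K _ _ ρ => ?_⟩
  let c : R → Y := fun x i => (b.repr x i : ZMod 3)
  have hc : ∀ x y, c x = c y → ∃ h, x - y = (3 : ℕ) • h := by
    intro x y hxy
    have hd : ∀ i, ∃ z, b.repr x i - b.repr y i = 3 * z := fun i => by
      have := congrFun hxy i
      exact (ZMod.intCast_eq_intCast_iff_dvd_sub _ _ 3).1 this.symm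
    choose z hz using hd
    refine ⟨b.equivFun.symm z, b.equivFun.injective ?_⟩
    ext i
    rw [map_nsmul, LinearEquiv.apply_symm_apply, map_sub]
    simpa using hz i
  refine Nat.card_le_card_of_injective
    (fun q : K ⧸ ρ.ker => c (ρ q.out)) fun q r hqr => ?_
  obtain ⟨h, hh⟩ := hc _ _ hqr
  rw [← q.out_eq, ← r.out_eq]
  refine (QuotientGroup.eq.2 ?_).symm
  refine eq_one_of_pow_eq_one_of_three_dvd (m := Nat.card K) Nat.card_pos ?_
    ⟨ρ (r.out)⁻¹ * h, ?_⟩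
  · rw [← map_pow, pow_card_eq_one', map_one]
  · rw [← mul_smul_comm, ← hh, mul_sub, ← map_mul, ← map_mul, inv_mul_cancel, map_one]

/-! ### Rosenlicht's theorem on units -/

open scoped WithZero nonZeroDivisors
open IsDedekindDomain

/-- A Dedekind domain that is a finite extension of a discrete valuation ring has only finitely
many nonzero primes. -/
theorem finite_heightOneSpectrum_of_finite (O C : Type*) [CommRing O] [IsDomain O]
    [IsDiscreteValuationRing O] [CommRing C] [IsDomain C] [Algebra O C] [Module.Finite O C]
    [FaithfulSMul O C] : Finite (HeightOneSpectrum C) := by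
  have hfin := Algebra.QuasiFinite.finite_primesOver (R := O) (S := C)
    (IsLocalRing.maximalIdeal O)
  have := hfin.to_subtype
  refine Finite.of_injective (β := (IsLocalRing.maximalIdeal O).primesOver C)
    (fun v => ⟨v.asIdeal, v.isPrime, ⟨?_⟩⟩) fun v w h => HeightOneSpectrum.ext (congrArg (·.1) h)
  have hne : v.asIdeal.under O ≠ ⊥ := by
    obtain ⟨x, hx, hx0⟩ := Submodule.exists_mem_ne_zero_of_ne_bot v.ne_bot
    exact Ideal.comap_ne_bot_of_integral_mem hx0 hx (Algebra.IsIntegral.isIntegral x)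
  exact (IsLocalRing.eq_maximalIdeal
    (Ring.DimensionLEOne.maximalOfPrime hne (v.isPrime.under O))).symm

/-- Let `L` be a finite extension of the fraction field of a discrete valuation ring `O`. The units
of `L` map to a free abelian group of finite rank so that every element of the kernel is integral
over `O`. -/
theorem exists_units_addMonoidHom_isIntegral (O F : Type*) {L : Type*} [CommRing O] [IsDomain O]
    [IsDiscreteValuationRing O] [Field F] [Algebra O F] [IsFractionRing O F] [Field L] [Algebra F L]
    [Algebra O L] [IsScalarTower O F L] [FiniteDimensional F L] [CharZero F] :
    ∃ (r : ℕ) (f : Additive Lˣ →+ (Fin r → ℤ)), ∀ u : Lˣ, f (.ofMul u) = 0 →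
      IsIntegral O (u : L) := by
  have hinj : Function.Injective (algebraMap O L) := by
    rw [IsScalarTower.algebraMap_eq O F L]
    exact (algebraMap F L).injective.comp (IsFractionRing.injective O F)
  have : FaithfulSMul O L := (faithfulSMul_iff_algebraMap_injective O L).2 hinj
  let C := integralClosure O L
  have : IsDedekindDomain C := integralClosure.isDedekindDomain O F L
  have : IsFractionRing C L := integralClosure.isFractionRing_of_finite_extension F L
  have : Module.Finite O C := IsIntegralClosure.finite O F L C
  have := finite_heightOneSpectrum_of_finite O C
  let e := Finite.equivFin (HeightOneSpectrum C)
  have hne : ∀ (v : HeightOneSpectrum C) (u : Lˣ), v.valuation L (u : L) ≠ 0 := fun v u =>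
    (Valuation.ne_zero_iff _).2 u.ne_zero
  -- The map records the valuations at the finitely many primes of the Dedekind domain `C`; elements
  -- with all valuations trivial lie in `C`.
  refine ⟨_, ⟨⟨fun u i => WithZero.log ((e.symm i).valuation L (u.toMul : L)), ?_⟩, ?_⟩, ?_⟩
  · ext i; simp
  · intro x y
    ext i
    simp [WithZero.log_mul (hne _ _) (hne _ _)]
  · intro u hu
    obtain ⟨c, hc⟩ := HeightOneSpectrum.mem_integers_of_valuation_le_one (R := C) L (u : L)
      fun v => by
        have := congrFun hu (e v)
        simp only [AddMonoidHom.coe_mk, ZeroHom.coe_mk, toMul_ofMul, Equiv.symm_apply_apply,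
          Pi.zero_apply] at this
        rw [← WithZero.exp_log (hne v u), this, WithZero.exp_zero]
    rw [← hc]
    exact c.2

/-- The valuation on a polynomial ring given by the total degree. -/
noncomputable def totalDegreeValuation (σ k : Type*) [Field k] :
    Valuation (MvPolynomial σ k) ℤᵐ⁰ := by
  classical
  exact
  { toFun f := if f = 0 then 0 else WithZero.exp (f.totalDegree : ℤ)
    map_zero' := by simp
    map_one' := by simp
    map_mul' f g := by
      by_cases hf : f = 0
      · simp [hf]
      by_cases hg : g = 0
      · simp [hg]
      simp [hf, hg, MvPolynomial.totalDegree_mul_of_isDomain hf hg]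
    map_add_le_max' f g := by
      by_cases hf : f = 0
      · simp [hf]
      by_cases hg : g = 0
      · simp [hg]
      by_cases hfg : f + g = 0
      · simp [hfg]
      simp only [hf, hg, hfg, if_false]
      rcases le_total f.totalDegree g.totalDegree with h | h
      · refine le_max_of_le_right (WithZero.exp_le_exp.2 ?_)
        exact_mod_cast (MvPolynomial.totalDegree_add f g).trans (max_le h le_rfl)
      · refine le_max_of_le_left (WithZero.exp_le_exp.2 ?_)
        exact_mod_cast (MvPolynomial.totalDegree_add f g).trans (max_le le_rfl h) }

theorem totalDegreeValuation_apply {σ k : Type*} [Field k] {f : MvPolynomial σ k} (hf : f ≠ 0) :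
    totalDegreeValuation σ k f = WithZero.exp (f.totalDegree : ℤ) := if_neg hf

theorem totalDegreeValuation_supp (σ k : Type*) [Field k] :
    (MvPolynomial σ k)⁰ ≤ (totalDegreeValuation σ k).supp.primeCompl := by
  intro f hf
  have hf0 := nonZeroDivisors.ne_zero hf
  change ¬ totalDegreeValuation σ k f = 0
  simp [totalDegreeValuation_apply hf0]

/-- The valuation on the field of fractions of a polynomial ring given by the total degree, that is,
by the order of pole along the hyperplane at infinity. -/
noncomputable def totalDegreeValuationFraction (σ k F : Type*) [Field k] [Field F]
    [Algebra (MvPolynomial σ k) F] [IsFractionRing (MvPolynomial σ k) F] : Valuation F ℤᵐ⁰ :=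
  (totalDegreeValuation σ k).extendToLocalization (totalDegreeValuation_supp σ k) F

section

variable {σ k F : Type*} [Field k] [Field F]
  [Algebra (MvPolynomial σ k) F] [IsFractionRing (MvPolynomial σ k) F]

theorem totalDegreeValuationFraction_algebraMap (f : MvPolynomial σ k) :
    totalDegreeValuationFraction σ k F (algebraMap _ F f) = totalDegreeValuation σ k f :=
  Valuation.extendToLocalization_apply_map_apply ..

/-- A polynomial without pole at infinity is constant. -/
theorem exists_eq_C_of_totalDegreeValuationFraction_le_one {f : MvPolynomial σ k}
    (hf : totalDegreeValuationFraction σ k F (algebraMap _ F f) ≤ 1) :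
    ∃ a, f = MvPolynomial.C a := by
  by_cases h0 : f = 0
  · exact ⟨0, by simp [h0]⟩
  rw [totalDegreeValuationFraction_algebraMap, totalDegreeValuation_apply h0,
    ← WithZero.exp_zero, WithZero.exp_le_exp] at hf
  exact ⟨_, MvPolynomial.totalDegree_eq_zero_iff_eq_C.1 (by exact_mod_cast hf.antisymm (by simp))⟩

/-- The value group is cyclic, and nontrivial because a variable has degree 1. -/
theorem isDiscreteValuationRing_totalDegreeValuationFraction [Nonempty σ] :
    IsDiscreteValuationRing (totalDegreeValuationFraction σ k F).valuationSubring := by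
  let v := totalDegreeValuationFraction σ k F
  have : IsCyclic (MonoidWithZeroHom.valueGroup (.ofClass v)) := inferInstance
  have : Nontrivial (MonoidWithZeroHom.valueGroup (.ofClass v)) := by
    obtain ⟨i⟩ := ‹Nonempty σ›
    have hX : v (algebraMap (MvPolynomial σ k) F (MvPolynomial.X i)) = WithZero.exp (1 : ℤ) := by
      rw [totalDegreeValuationFraction_algebraMap,
        totalDegreeValuation_apply (MvPolynomial.X_ne_zero i), MvPolynomial.totalDegree_X]
      rfl
    refine Subgroup.nontrivial_iff_exists_ne_one _ |>.2
      ⟨Units.mk0 (WithZero.exp (1 : ℤ)) WithZero.exp_ne_zero,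
        Subgroup.subset_closure ⟨_, hX⟩, fun h => ?_⟩
    simpa using congrArg Units.val h
  exact Valuation.valuationSubring_isDiscreteValuationRing v

/-- An element of a field extension of `k(x₁, …, xₙ)` that is integral over `k[x₁, …, xₙ]` and over
the valuation ring of the hyperplane at infinity is algebraic over `k`. -/
theorem isIntegral_of_isIntegral_totalDegreeValuationFraction {L : Type*} [Field L] [Algebra F L]
    [Algebra (MvPolynomial σ k) L] [IsScalarTower (MvPolynomial σ k) F L] [Algebra k L]
    [IsScalarTower k (MvPolynomial σ k) L] {x : L} (h : IsIntegral (MvPolynomial σ k) x)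
    (h' : IsIntegral (totalDegreeValuationFraction σ k F).valuationSubring x) :
    IsIntegral k x := by
  set O := (totalDegreeValuationFraction σ k F).valuationSubring
  -- Both base rings are integrally closed, so the minimal polynomial over `F` has coefficients in
  -- both; polynomials without pole at infinity are constants.
  have h1 := minpoly.isIntegrallyClosed_eq_field_fractions' F h
  have h2 := minpoly.isIntegrallyClosed_eq_field_fractions' F h'
  have h3 : ∀ n, ∃ a, (minpoly (MvPolynomial σ k) x).coeff n = MvPolynomial.C a := by
    intro n
    refine exists_eq_C_of_totalDegreeValuationFraction_le_one (F := F) ?_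
    have := congrArg (Polynomial.coeff · n) (h1.symm.trans h2)
    simp only [Polynomial.coeff_map] at this
    rw [this]
    exact ((minpoly O x).coeff n).2
  have h4 : minpoly (MvPolynomial σ k) x ∈ Polynomial.lifts (algebraMap k (MvPolynomial σ k)) := by
    rw [Polynomial.lifts_iff_coeff_lifts]
    intro n
    obtain ⟨a, ha⟩ := h3 n
    exact ⟨a, ha.symm⟩
  obtain ⟨q, hq, -, hqm⟩ := Polynomial.lifts_and_degree_eq_and_monic h4 (minpoly.monic h)
  refine ⟨q, hqm, ?_⟩
  rw [← Polynomial.aeval_def, ← Polynomial.aeval_map_algebraMap (MvPolynomial σ k), hq,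
    minpoly.aeval]

end

theorem mem_range_algebraMap_of_isIntegral {k B : Type*} [Field k] [IsAlgClosed k] [CommRing B]
    [IsDomain B] [Algebra k B] {x : B} (hx : IsIntegral k x) : x ∈ (algebraMap k B).range :=
  minpoly.mem_range_of_degree_eq_one k x
    (IsAlgClosed.degree_eq_one_of_irreducible k (minpoly.irreducible hx))

/-- **Rosenlicht's theorem**: the group of units of a finitely generated domain over an algebraically
closed field `k` is, modulo the constants, a subgroup of a free abelian group of finite rank. -/
theorem exists_units_addMonoidHom_mem_range (k B : Type*) [Field k] [IsAlgClosed k] [CharZero k]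
    [CommRing B] [IsDomain B] [Algebra k B] [Algebra.FiniteType k B] :
    ∃ (r : ℕ) (f : Additive Bˣ →+ (Fin r → ℤ)), ∀ u : Bˣ, f (.ofMul u) = 0 →
      (u : B) ∈ (algebraMap k B).range := by
  obtain ⟨s, g, hg, hfin⟩ := exists_finite_inj_algHom_of_fg k B
  let := g.toRingHom.toAlgebra
  let P := MvPolynomial (Fin s) k
  have : IsScalarTower k P B := .of_algebraMap_eq' g.comp_algebraMap.symm
  have : Module.Finite P B := hfin
  have : FaithfulSMul P B := (faithfulSMul_iff_algebraMap_injective P B).2 hg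
  let F := FractionRing P
  let L := FractionRing B
  let := FractionRing.liftAlgebra P L
  have := FractionRing.isScalarTower_liftAlgebra P L
  have : FiniteDimensional F L := inferInstance
  have : CharZero F := inferInstance
  have : IsScalarTower k P L := inferInstance
  have hL : ∀ x : B, IsIntegral k (algebraMap B L x) → x ∈ (algebraMap k B).range := fun x hx =>
    mem_range_algebraMap_of_isIntegral
      ((isIntegral_algebraMap_iff (IsFractionRing.injective B L)).1 hx)
  have hPL : ∀ x : B, IsIntegral P (algebraMap B L x) := fun x =>
    (Algebra.IsIntegral.isIntegral x).algebraMap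
  -- Without variables there is no hyperplane at infinity, but then `B` is already integral over
  -- `k`.
  rcases isEmpty_or_nonempty (Fin s) with hs | hs
  · refine ⟨0, 0, fun u _ => hL _ ?_⟩
    have : Algebra.IsIntegral k P :=
      Algebra.isIntegral_of_surjective (MvPolynomial.C_surjective (Fin s))
    exact isIntegral_trans _ (hPL u)
  · let O := (totalDegreeValuationFraction (Fin s) k F).valuationSubring
    have : IsDiscreteValuationRing O := isDiscreteValuationRing_totalDegreeValuationFraction
    obtain ⟨r, f, hf⟩ := exists_units_addMonoidHom_isIntegral O F (L := L)
    refine ⟨r, f.comp (Units.map (algebraMap B L).toMonoidHom).toAdditive, fun u hu => hL _ ?_⟩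
    exact isIntegral_of_isIntegral_totalDegreeValuationFraction (F := F) (hPL u) (hf _ hu)

theorem IsJordanGroup.of_injective {G : Type u} {H : Type*} [Group G] [Group H] (f : G →* H)
    (hf : Function.Injective f) (hH : IsJordanGroup H) : IsJordanGroup G := by
  obtain ⟨d, hd, h⟩ := hH
  refine ⟨d, hd, fun K hK => ?_⟩
  obtain ⟨A, hA, hc, hi⟩ := h (K.map f) (Set.Finite.image f (Set.toFinite (K : Set G))).to_subtype
  let e : K ≃* K.map f := K.equivMapOfInjective f hf
  refine ⟨A.comap e.toMonoidHom, inferInstance, fun a ha b hb => e.injective ?_, ?_⟩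
  · simpa using hc _ ha _ hb
  · rwa [Subgroup.index_comap_of_surjective _ e.surjective]

theorem Submodule.finite_quotient_of_ker_le {R N V : Type*} [Ring R] [AddCommGroup N] [Module R N]
    [AddCommGroup V] [Module R V] [IsNoetherian R V] (f : N →ₗ[R] V) {T : Submodule R N}
    (h : LinearMap.ker f ≤ T) : Module.Finite R (N ⧸ T) := by
  have : Module.Finite R (N ⧸ LinearMap.ker f) :=
    Module.Finite.equiv f.quotKerEquivRange.symm
  exact Module.Finite.of_surjective (Submodule.factor h) (Submodule.factor_surjective h)

/-! ### Automorphisms acting on components and units -/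

section

variable (k A : Type*) [Field k] [CommRing A] [Algebra k A]

/-- The units of a `k`-algebra that are constant on every irreducible component. -/
def componentwiseConstantUnits : Subgroup Aˣ :=
  ⨅ p : minimalPrimes A, (Units.map (algebraMap k (A ⧸ p.1)).toMonoidHom).range.comap
    (Units.map (Ideal.Quotient.mk p.1).toMonoidHom)

variable {k A}

theorem mem_componentwiseConstantUnits {u : Aˣ} : u ∈ componentwiseConstantUnits k A ↔
    ∀ p ∈ minimalPrimes A, ∃ c : k, (u : A) - algebraMap k A c ∈ p := by
  simp only [componentwiseConstantUnits, Subgroup.mem_iInf, Subtype.forall, Subgroup.mem_comap,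
    MonoidHom.mem_range]
  refine forall₂_congr fun p hp => ⟨fun ⟨c, hc⟩ => ⟨c, ?_⟩, fun ⟨c, hc⟩ => ?_⟩
  · rw [← Ideal.Quotient.mk_eq_mk_iff_sub_mem]
    exact (congrArg Units.val hc).symm
  · rw [← Ideal.Quotient.mk_eq_mk_iff_sub_mem] at hc
    have : p.IsPrime := hp.1.1
    have hc0 : c ≠ 0 := by
      rintro rfl
      rw [map_zero, map_zero] at hc
      exact (u.isUnit.map (Ideal.Quotient.mk p)).ne_zero hc
    exact ⟨Units.mk0 c hc0, Units.ext hc.symm⟩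

theorem AlgEquiv.comap_mem_minimalPrimes (σ : A ≃ₐ[k] A) {p : Ideal A} (hp : p ∈ minimalPrimes A) :
    p.comap σ ∈ minimalPrimes A := by
  have : p.IsPrime := hp.1.1
  refine ⟨⟨inferInstance, bot_le⟩, fun q hq hqp => ?_⟩
  have : q.IsPrime := hq.1
  have h := hp.2 (y := q.comap σ.symm) ⟨inferInstance, bot_le⟩ fun x hx => by
    simpa using hqp hx
  intro x hx
  simpa using h hx

/-- The action of the automorphisms of an algebra on its minimal primes. -/
def AlgEquiv.permMinimalPrimes : (A ≃ₐ[k] A) →* Equiv.Perm (minimalPrimes A) where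
  toFun σ :=
    { toFun p := ⟨p.1.comap σ.symm, σ.symm.comap_mem_minimalPrimes p.2⟩
      invFun p := ⟨p.1.comap σ, σ.comap_mem_minimalPrimes p.2⟩
      left_inv p := by ext; simp
      right_inv p := by ext; simp }
  map_one' := rfl
  map_mul' _ _ := rfl

theorem map_mem_componentwiseConstantUnits (σ : A ≃ₐ[k] A) {u : Aˣ}
    (hu : u ∈ componentwiseConstantUnits k A) :
    Units.map (σ : A →* A) u ∈ componentwiseConstantUnits k A := by
  rw [mem_componentwiseConstantUnits] at hu ⊢
  intro p hp
  obtain ⟨c, hc⟩ := hu _ (σ.comap_mem_minimalPrimes hp)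
  exact ⟨c, by simpa using hc⟩

/-- In a reduced algebra the automorphisms that preserve every irreducible component fix the units
that are constant on every irreducible component. -/
theorem AlgEquiv.apply_eq_of_permMinimalPrimes_eq_one [_root_.IsReduced A] {σ : A ≃ₐ[k] A}
    (hσ : AlgEquiv.permMinimalPrimes σ = 1) {u : Aˣ} (hu : u ∈ componentwiseConstantUnits k A) :
    σ u = u := by
  rw [mem_componentwiseConstantUnits] at hu
  -- Modulo each minimal prime, `σ u` and `u` reduce to the same constant.
  have h : σ u - u ∈ sInf (minimalPrimes A) := by
    rw [Ideal.mem_sInf]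
    intro p hp
    obtain ⟨c, hc⟩ := hu p hp
    have hp' : p.comap σ.symm = p := congrArg Subtype.val (Equiv.congr_fun hσ ⟨p, hp⟩)
    have h1 : σ u - algebraMap k A c ∈ p := by
      rw [← hp']
      simpa using hc
    simpa using sub_mem h1 hc
  have h0 : sInf (minimalPrimes A) = ⊥ := by
    rw [minimalPrimes, Ideal.sInf_minimalPrimes]
    exact nilradical_eq_zero A
  rw [h0] at h
  exact sub_eq_zero.1 h

variable (k A) in
/-- The subgroup `componentwiseConstantUnits` in additive notation. -/
abbrev additiveComponentwiseConstantUnits : Submodule ℤ (Additive Aˣ) :=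
  AddSubgroup.toIntSubmodule (Subgroup.toAddSubgroup (componentwiseConstantUnits k A))

variable (k A) in
/-- The action of the automorphisms of an algebra on its units modulo the componentwise constant
ones. -/
def AlgEquiv.unitsQuotientEnd : (A ≃ₐ[k] A) →*
    Module.End ℤ (Additive Aˣ ⧸ additiveComponentwiseConstantUnits k A) where
  toFun σ := Submodule.mapQ _ _ (Units.map (σ : A →* A)).toAdditive.toIntLinearMap
    fun _ hu => map_mem_componentwiseConstantUnits σ hu
  map_one' := by
    ext u
    rfl
  map_mul' σ τ := by
    ext u
    rfl

theorem AlgEquiv.exists_apply_eq_mul_of_unitsQuotientEnd_eq_one {σ : A ≃ₐ[k] A}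
    (hσ : AlgEquiv.unitsQuotientEnd k A σ = 1) (u : Aˣ) :
    ∃ t ∈ componentwiseConstantUnits k A, σ u = t * u := by
  have h := LinearMap.congr_fun hσ (Submodule.Quotient.mk (Additive.ofMul u))
  have h' := (Submodule.Quotient.eq _).1 h
  exact ⟨Units.map (σ : A →* A) u / u, h', by simp [← Units.val_mul]⟩

/-- In a reduced algebra generated by units the automorphisms that preserve every irreducible
component, and every unit modulo the componentwise constant ones, commute. -/
theorem AlgEquiv.mul_comm_of_unitsQuotientEnd_eq_one [_root_.IsReduced A]
    (hA : Algebra.adjoin k {x : A | IsUnit x} = ⊤) {σ τ : A ≃ₐ[k] A}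
    (hσ : AlgEquiv.permMinimalPrimes σ = 1) (hτ : AlgEquiv.permMinimalPrimes τ = 1)
    (hσ' : AlgEquiv.unitsQuotientEnd k A σ = 1) (hτ' : AlgEquiv.unitsQuotientEnd k A τ = 1) :
    σ * τ = τ * σ := by
  suffices ((σ * τ : A ≃ₐ[k] A) : A →ₐ[k] A) = (τ * σ : A ≃ₐ[k] A) from
    AlgEquiv.ext fun x => DFunLike.congr_fun this x
  refine AlgHom.ext_of_adjoin_eq_top hA ?_
  rintro _ ⟨u, rfl⟩
  obtain ⟨s, hs, hsu⟩ := AlgEquiv.exists_apply_eq_mul_of_unitsQuotientEnd_eq_one hσ' u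
  obtain ⟨t, ht, htu⟩ := AlgEquiv.exists_apply_eq_mul_of_unitsQuotientEnd_eq_one hτ' u
  change σ (τ u) = τ (σ u)
  rw [hsu, htu, map_mul, map_mul, AlgEquiv.apply_eq_of_permMinimalPrimes_eq_one hσ ht,
    AlgEquiv.apply_eq_of_permMinimalPrimes_eq_one hτ hs, hsu, htu, mul_left_comm]

variable (k A) in
theorem finite_units_quotient [IsAlgClosed k] [CharZero k] [Algebra.FiniteType k A] :
    Module.Finite ℤ (Additive Aˣ ⧸ additiveComponentwiseConstantUnits k A) := by
  have : IsNoetherianRing A := Algebra.FiniteType.isNoetherianRing k A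
  have : Finite (minimalPrimes A) := (minimalPrimes.finite_of_isNoetherianRing A).to_subtype
  have hp : ∀ p : minimalPrimes A, ∃ (r : ℕ) (f : Additive (A ⧸ p.1)ˣ →+ (Fin r → ℤ)),
      ∀ u : (A ⧸ p.1)ˣ, f (.ofMul u) = 0 → (u : A ⧸ p.1) ∈ (algebraMap k (A ⧸ p.1)).range :=
    fun p => by
      have : p.1.IsPrime := p.2.1.1
      exact exists_units_addMonoidHom_mem_range k (A ⧸ p.1)
  choose r f hf using hp
  refine Submodule.finite_quotient_of_ker_le (V := ∀ p, Fin (r p) → ℤ)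
    (LinearMap.pi fun p => ((f p).comp
      (Units.map (Ideal.Quotient.mk p.1).toMonoidHom).toAdditive).toIntLinearMap) ?_
  intro u hu
  refine mem_componentwiseConstantUnits.2 fun p hp => ?_
  obtain ⟨c, hc⟩ := hf ⟨p, hp⟩ _ (congrFun hu ⟨p, hp⟩)
  exact ⟨c, (Ideal.Quotient.mk_eq_mk_iff_sub_mem _ _).1 hc.symm⟩

variable (k A) in
-- If a power of a unit is constant on a component, the unit is algebraic over `k` there, hence
-- constant.
theorem isTorsionFree_units_quotient [IsAlgClosed k] :
    Module.IsTorsionFree ℤ (Additive Aˣ ⧸ additiveComponentwiseConstantUnits k A) := by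
  have h : ∀ (n : ℕ) (u : Aˣ), n ≠ 0 → u ^ n ∈ componentwiseConstantUnits k A →
      u ∈ componentwiseConstantUnits k A := by
    intro n u hn hu
    rw [mem_componentwiseConstantUnits] at hu ⊢
    intro p hp
    have : p.IsPrime := hp.1.1
    obtain ⟨c, hc⟩ := hu p hp
    rw [← Ideal.Quotient.mk_eq_mk_iff_sub_mem, Units.val_pow_eq_pow_val, map_pow] at hc
    obtain ⟨b, hb⟩ := mem_range_algebraMap_of_isIntegral (k := k)
      (x := Ideal.Quotient.mk p (u : A)) (IsIntegral.of_pow (Nat.pos_of_ne_zero hn) (by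
        rw [hc]
        exact isIntegral_algebraMap (A := A ⧸ p) (x := c)))
    exact ⟨b, (Ideal.Quotient.mk_eq_mk_iff_sub_mem _ _).1 hb.symm⟩
  rw [Module.isTorsionFree_int_iff_isAddTorsionFree]
  refine ⟨fun n hn => (injective_iff_map_eq_zero
    (nsmulAddMonoidHom (α := Additive Aˣ ⧸ additiveComponentwiseConstantUnits k A) n)).2 fun x hx => ?_⟩
  obtain ⟨u, rfl⟩ := Submodule.Quotient.mk_surjective _ x
  exact (Submodule.Quotient.mk_eq_zero _).2 (h n u.toMul hn ((Submodule.Quotient.mk_eq_zero _).1 hx))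

/-- The automorphism group of a reduced finitely generated algebra that is generated by units is
Jordan. -/
theorem isJordanGroup_algEquiv [IsAlgClosed k] [CharZero k] [Algebra.FiniteType k A]
    [_root_.IsReduced A] (hA : Algebra.adjoin k {x : A | IsUnit x} = ⊤) :
    IsJordanGroup (A ≃ₐ[k] A) := by
  have : IsNoetherianRing A := Algebra.FiniteType.isNoetherianRing k A
  have : Finite (minimalPrimes A) := (minimalPrimes.finite_of_isNoetherianRing A).to_subtype
  have := finite_units_quotient k A
  have := isTorsionFree_units_quotient k A
  have : Module.Free ℤ (Additive Aˣ ⧸ additiveComponentwiseConstantUnits k A) :=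
    Module.free_of_finite_type_torsion_free'
  obtain ⟨d, hd, h⟩ := exists_forall_index_ker_le
    (Module.End ℤ (Additive Aˣ ⧸ additiveComponentwiseConstantUnits k A))
  refine ⟨Nat.card (Equiv.Perm (minimalPrimes A)) * d, mul_pos Nat.card_pos hd, fun K _ => ?_⟩
  let π := (AlgEquiv.permMinimalPrimes (k := k) (A := A)).comp K.subtype
  let ρ := (AlgEquiv.unitsQuotientEnd k A).comp K.subtype
  refine ⟨π.ker ⊓ ρ.ker, inferInstance, fun a ha b hb => Subtype.ext ?_,
    Subgroup.index_inf_le.trans (Nat.mul_le_mul ?_ (h K ρ))⟩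
  · exact AlgEquiv.mul_comm_of_unitsQuotientEnd_eq_one hA ha.1 hb.1 ha.2 hb.2
  · rw [Subgroup.index_ker]
    exact Subgroup.card_le_card_group _

end

/-! ### Functions on toral varieties -/

theorem AlgebraicGeometry.Scheme.basicOpen_prod {X : Scheme.{u}} {ι : Type*}
    (s : Finset ι) (f : ι → Γ(X, ⊤)) :
    X.basicOpen (∏ i ∈ s, f i) = ⨅ i ∈ s, X.basicOpen (f i) := by
  classical
  induction s using Finset.induction_on with
  | empty => simp
  | insert a s ha ih => rw [Finset.prod_insert ha, Scheme.basicOpen_mul, ih, Finset.iInf_insert]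

theorem coordTorusOpens_eq_basicOpen (k : Type u) [Field k] (n : ℕ) :
    coordTorusOpens k n = Scheme.basicOpen _ (∏ i, AffineSpace.coord (Spec (.of k)) i) := by
  rw [Scheme.basicOpen_prod]
  simp [coordTorusOpens]

/-- A section over a basic open subset of an affine scheme is a fraction. -/
theorem AlgebraicGeometry.Scheme.exists_appTop_ι_eq_mul_pow {Y : Scheme.{u}} [IsAffine Y]
    {f : Γ(Y, ⊤)} {U : Y.Opens} (hU : U = Y.basicOpen f) :
    IsUnit (U.ι.appTop f) ∧ ∀ y : Γ(U, ⊤), ∃ (n : ℕ) (a : Γ(Y, ⊤)),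
      y * U.ι.appTop f ^ n = U.ι.appTop a := by
  have h := (isAffineOpen_top Y).isLocalization_of_eq_basicOpen f
    (V := U.ι ''ᵁ ⊤) (homOfLE le_top) (by simpa using hU)
  algebraize [(Y.presheaf.map (homOfLE (le_top : U.ι ''ᵁ ⊤ ≤ ⊤)).op).hom]
  refine ⟨IsLocalization.Away.algebraMap_isUnit (S := Γ(Y, U.ι ''ᵁ ⊤)) f, fun y => ?_⟩
  obtain ⟨n, a, h⟩ := IsLocalization.Away.surj (S := Γ(Y, U.ι ''ᵁ ⊤)) f y
  exact ⟨n, a, h⟩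

theorem AlgebraicGeometry.AffineSpace.exists_eq_eval₂ {σ R : Type u} [CommRing R]
    (a : Γ(AffineSpace σ (Spec (.of R)), ⊤)) : ∃ p : MvPolynomial σ R,
      a = MvPolynomial.eval₂Hom ((Scheme.ΓSpecIso (.of R)).inv ≫
        (AffineSpace σ (Spec (.of R)) ↘ Spec (.of R)).appTop).hom
          (AffineSpace.coord (Spec (.of R))) p := by
  let e := AffineSpace.SpecIso σ (.of R)
  refine ⟨(Scheme.ΓSpecIso (.of (MvPolynomial σ R))).hom (e.inv.appTop a), ?_⟩
  have h1 : e.inv.appTop ≫ e.hom.appTop = 𝟙 _ := by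
    rw [← Scheme.Hom.comp_appTop, Iso.hom_inv_id]; rfl
  have h2 := AffineSpace.SpecIso_hom_appTop (n := σ) (.of R)
  have h3 := congrArg (fun φ => φ.hom a) h1
  rw [h2] at h3
  exact h3.symm

section

variable {k : Type u} [Field k]

/-- The `k`-algebra structure on the global sections of a scheme over `k`. -/
noncomputable abbrev globalSectionsAlgebra (X : Over (Spec (CommRingCat.of k))) :
    Algebra k Γ(X.left, ⊤) :=
  ((Scheme.ΓSpecIso (.of k)).inv ≫ X.hom.appTop).hom.toAlgebra

attribute [local instance] globalSectionsAlgebra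

/-- Functions on the torus are polynomials divided by powers of the product of the coordinates, and
they restrict onto those of a closed subscheme; so the coordinates and their inverses generate. -/
theorem exists_finite_units_adjoin_eq_top {X : Over (Spec (CommRingCat.of k))} (hT : IsToral k X) :
    IsAffine X.left ∧ ∃ s : Set Γ(X.left, ⊤), s.Finite ∧ (∀ x ∈ s, IsUnit x) ∧
      Algebra.adjoin k s = ⊤ := by
  obtain ⟨n, i, hi⟩ := hT
  have hU := coordTorusOpens_eq_basicOpen k n
  have : IsAffine (coordTorus k n).left := by
    change IsAffineOpen (coordTorusOpens k n)
    rw [hU]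
    exact (isAffineOpen_top _).basicOpen _
  obtain ⟨hX, hsurj⟩ := IsClosedImmersion.isAffine_surjective_of_isAffine i.left
  obtain ⟨hunit, hfrac⟩ := Scheme.exists_appTop_ι_eq_mul_pow hU
  let j : X.left ⟶ AffineSpace (ULift.{u} (Fin n)) (Spec (CommRingCat.of k)) :=
    i.left ≫ (coordTorusOpens k n).ι
  have hj : j ≫ (AffineSpace (ULift.{u} (Fin n)) (Spec (CommRingCat.of k)) ↘
      Spec (CommRingCat.of k)) = X.hom := by
    exact (Category.assoc _ _ _).trans (Over.w i)
  let x : ULift.{u} (Fin n) → Γ(X.left, ⊤) := fun l => j.appTop (AffineSpace.coord _ l)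
  have hprod : IsUnit (∏ l, x l) := by
    rw [← map_prod]
    exact hunit.map i.left.appTop.hom
  have hx : ∀ l, IsUnit (x l) := fun l =>
    isUnit_of_dvd_unit (Finset.dvd_prod_of_mem _ (Finset.mem_univ l)) hprod
  refine ⟨hX, Set.range x ∪ Set.range fun l => ((hx l).unit⁻¹ : Units _).val, Set.toFinite _, ?_, ?_⟩
  · rintro _ (⟨l, rfl⟩ | ⟨l, rfl⟩)
    exacts [hx l, Units.isUnit _]
  set S := Algebra.adjoin k (Set.range x ∪ Set.range fun l => ((hx l).unit⁻¹ : Units _).val)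
  have hpoly : ∀ a, j.appTop a ∈ S := by
    intro a
    obtain ⟨p, rfl⟩ := AffineSpace.exists_eq_eval₂ a
    have h1 : j.appTop (MvPolynomial.eval₂Hom ((Scheme.ΓSpecIso (.of k)).inv ≫
        (AffineSpace (ULift.{u} (Fin n)) (Spec (.of k)) ↘ Spec (.of k)).appTop).hom
          (AffineSpace.coord (Spec (.of k))) p) = MvPolynomial.aeval x p := by
      rw [MvPolynomial.aeval_def, MvPolynomial.coe_eval₂Hom]
      erw [MvPolynomial.hom_eval₂]
      congr 1
      change _ = ((Scheme.ΓSpecIso (.of k)).inv ≫ X.hom.appTop).hom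
      rw [← hj, Scheme.Hom.comp_appTop]
      rfl
    rw [h1]
    refine (?_ : Algebra.adjoin k (Set.range x) ≤ S) ?_
    · exact Algebra.adjoin_mono Set.subset_union_left
    · rw [Algebra.adjoin_range_eq_range_aeval]; exact ⟨p, rfl⟩
  rw [eq_top_iff]
  rintro y -
  obtain ⟨z, rfl⟩ := hsurj y
  obtain ⟨m, a, ha⟩ := hfrac z
  rw [← map_pow] at ha
  have h2 : i.left.appTop z * (∏ l, x l) ^ m = j.appTop a := by
    rw [← map_prod, ← map_pow]
    exact (i.left.appTop.hom.map_mul _ _).symm.trans (congrArg i.left.appTop.hom ha)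
  have h3 : i.left.appTop z = j.appTop a * (∏ l, ((hx l).unit⁻¹ : Units _).val) ^ m := by
    rw [← h2, mul_assoc, ← mul_pow, ← Finset.prod_mul_distrib]
    simp
  rw [h3]
  exact S.mul_mem (hpoly a) (S.pow_mem (S.prod_mem fun l _ =>
    Algebra.subset_adjoin (Or.inr ⟨l, rfl⟩)) m)

/-! ### From automorphisms of the variety to those of its coordinate ring -/

/-- The action of the automorphisms of a scheme over `k` on its global sections. -/
noncomputable def autToAlgEquiv (X : Over (Spec (CommRingCat.of k))) :
    Aut X →* (Γ(X.left, ⊤) ≃ₐ[k] Γ(X.left, ⊤)) where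
  toFun f :=
    -- Pullback reverses composition, so the inverse is used to get a homomorphism.
    { toFun := f.inv.left.appTop
      invFun := f.hom.left.appTop
      left_inv x := by
        rw [← CommRingCat.comp_apply, ← Scheme.Hom.comp_appTop, ← Over.comp_left, f.hom_inv_id]
        rfl
      right_inv x := by
        rw [← CommRingCat.comp_apply, ← Scheme.Hom.comp_appTop, ← Over.comp_left, f.inv_hom_id]
        rfl
      map_mul' := map_mul _
      map_add' := map_add _
      commutes' c := by
        change f.inv.left.appTop (X.hom.appTop ((Scheme.ΓSpecIso (.of k)).inv c)) =
          X.hom.appTop ((Scheme.ΓSpecIso (.of k)).inv c)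
        rw [← CommRingCat.comp_apply, ← Scheme.Hom.comp_appTop, Over.w] }
  map_one' := rfl
  map_mul' f g := by
    ext x
    change (f * g).inv.left.appTop x = f.inv.left.appTop (g.inv.left.appTop x)
    rw [← CommRingCat.comp_apply, ← Scheme.Hom.comp_appTop, ← Over.comp_left]
    rfl

theorem autToAlgEquiv_injective (X : Over (Spec (CommRingCat.of k))) [IsAffine X.left] :
    Function.Injective (autToAlgEquiv X) := by
  intro f g h
  refine Iso.ext_inv (Over.OverMorphism.ext (ext_of_isAffine ?_))
  ext x
  exact DFunLike.congr_fun h x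

end

theorem theorem2p16 (k : Type u) [Field k] [IsAlgClosed k] [CharZero k]
    (X : Over (Spec (CommRingCat.of k))) (hX : IsVarietyOver k X) (hT : IsToral k X) :
    IsJordanGroup (Aut X) := by
  let := globalSectionsAlgebra X
  obtain ⟨_, s, hs, hunit, hadj⟩ := exists_finite_units_adjoin_eq_top hT
  have := hX.isReduced
  have : Algebra.FiniteType k Γ(X.left, ⊤) := ⟨Subalgebra.fg_def.2 ⟨s, hs, hadj⟩⟩
  have hgen : Algebra.adjoin k {x : Γ(X.left, ⊤) | IsUnit x} = ⊤ :=
    eq_top_iff.2 (hadj.ge.trans (Algebra.adjoin_mono hunit))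
  exact (isJordanGroup_algEquiv hgen).of_injective (autToAlgEquiv X) (autToAlgEquiv_injective X)
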